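/- Let $G=(V,E)$ be a finite simple undirected graph, $n=|V|$, and let $\mathcal Z\subseteq\mathbb R_{\ge 0}^{E}$ be a set of nonnegative edge-weight vectors (for instance a convex compact uncertainty set). For $w\in\mathcal Z$ let $L(w)=\sum_{\{i,j\}\in E}w_{ij}(E_{ii}+E_{jj}-E_{ij}-E_{ji})$ be the weighted Laplacian and let $$mc(G,w)=\max_{S\subseteq V}\ \sum_{e\in E,\ |e\cap S|=1}w_e$$ be the maximum weight of a cut. The robust max-cut SDP relaxation is $$\max_{Y\in\mathcal X}\ \min_{w\in\mathcal Z}\ \bigl\langle \tfrac14L(w),Y\bigr\rangle ,\qquad \mathcal X=\{Y\in\mathbb R^{V\times V}: Y\succeq 0,\ Y_{ii}=1\ \text{for all } i\in V\}.$$ For $Y^*,\bar Y\in\mathcal X$, say that $Y^*$ Pareto dominates $\bar Y$ if $\langle \frac14L(w),Y^*\rangle\ge\langle \frac14L(w),\bar Y\rangle$ for all $w\in\mathcal Z$, with strict inequality for at least one $w\in\mathcal Z$. For $Y\in\mathcal X$ put $$sdp(G,w,Y)=\frac14\sum_{(i,j):\,\{i,j\}\in E}w_{ij}(1-Y_{ij}),$$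 where the sum runs over ordered pairs (so every edge is counted twice); if $Y=B^\top B$ and $y_k$ is the $k$-th column of $B$, then $Y_{ij}=y_i^\top y_j$. Finally let $$\alpha=\inf_{0<\theta\le\pi}\frac{2}{\pi}\,\frac{\theta}{1-\cos\theta}$$ be the Goemans–Williamson constant. Suppose that $Y^*$ Pareto dominates $\bar Y$. Then $0.878<\alpha<0.879$, and: 1. for every $w\in\mathcal Z$, $\ mc(G,w)\ \ge\ \alpha\, sdp(G,w,Y^*)\ \ge\ \alpha\, sdp(G,w,\bar Y)$; 2. there is a $w\in\mathcal Z$ with $\alpha\, sdp(G,w,Y^*)>\alpha\, sdp(G,w,\bar Y)$; 3. the bound is realized in expectation by the Goemans–Williamson cuts rounded from $Y^*$: for every factorization $Y^*=B^\top B$ with $B\in\mathbb R^{V\times V}$ (for instance a Cholesky factorization), with columns $y^*_k$, if $r$ is uniformly distributed on the unit sphere of $\mathbb R^{V}$ and $S_r=\{k\in V:(y_k^*)^\top r\ge 0\}$, then for every $w\in\mathcal Z$ the weight of the cut defined by $S_r$ is integrable and $$mc(G,w)\ \ge\ \mathbb E_r\Bigl[\sum_{e\in E,\ |e\cap S_r|=1}w_e\Bigr]\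 \ge\ \alpha\, sdp(G,w,Y^*).$$ -/

import Mathlib

open MeasureTheory

/-- For a robust problem `sup_{x ∈ 𝒳} min_{p ∈ 𝒰} f x p`: the feasible point `x'` Pareto dominates
the feasible point `x` if it is at least as good in every scenario and strictly better in one.
(The dominated point `x` may, but need not, be robustly optimal.) -/
def ParetoDominates {α β : Type*} (𝒳 : Set α) (𝒰 : Set β) (f : α → β → ℝ) (x' x : α) : Prop :=
  x' ∈ 𝒳 ∧ x ∈ 𝒳 ∧ (∀ p ∈ 𝒰, f x p ≤ f x' p) ∧ ∃ p ∈ 𝒰, f x p < f x' p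

/-- The matrix `E_ii + E_jj - E_ij - E_ji` of an edge `{i, j}`. -/
def edgeLaplacian {V : Type*} [DecidableEq V] : Sym2 V → Matrix V V ℝ :=
  Sym2.lift ⟨fun i j => Matrix.single i i 1 + Matrix.single j j 1
    - Matrix.single i j 1 - Matrix.single j i 1, fun i j => by dsimp only; abel⟩

section MaxCut

variable {V : Type*} [Fintype V] [DecidableEq V] (G : SimpleGraph V) [DecidableRel G.Adj]

/-- The weighted Laplacian `L(w)` of `G`, for `w ∈ ℝ^E`. -/
def weightedLaplacian (w : G.edgeSet → ℝ) : Matrix V V ℝ :=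
  ∑ e : G.edgeSet, w e • edgeLaplacian (e : Sym2 V)

/-- The weight of the cut `δ(S) = {e ∈ E : |e ∩ S| = 1}`. -/
def cutWeight (w : G.edgeSet → ℝ) (S : Finset V) : ℝ :=
  ∑ e : G.edgeSet, if ((e : Sym2 V).toFinset ∩ S).card = 1 then w e else 0

/-- The maximum weight `mc(G, w)` of a cut of `G`. -/
def maxCut (w : G.edgeSet → ℝ) : ℝ :=
  (Finset.univ : Finset (Finset V)).sup' Finset.univ_nonempty (cutWeight G w)

/-- The feasible set of the max-cut SDP relaxation: positive semidefinite, unit diagonal. -/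
def sdpFeasible (V : Type*) : Set (Matrix V V ℝ) :=
  {Y | Y.PosSemidef ∧ ∀ i, Y i i = 1}

/-- The objective `⟨L(w)/4, Y⟩` (trace inner product) of the max-cut SDP relaxation. -/
noncomputable def sdpObjective (Y : Matrix V V ℝ) (w : G.edgeSet → ℝ) : ℝ :=
  Matrix.trace ((((1 / 4 : ℝ) • weightedLaplacian G w).transpose) * Y)

/-- `sdp(G, w, Y) = 1/4 ∑ w_ij (1 - Y_ij)`, the sum being over ordered pairs `(i, j)` with
`{i, j} ∈ E`. Here `Y_ij` is the inner product of columns `i` and `j` of a Gram factor of `Y`. -/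
noncomputable def sdpValue (w : G.edgeSet → ℝ) (Y : Matrix V V ℝ) : ℝ :=
  (1 / 4) * ∑ d : G.Dart, w ⟨d.edge, d.edge_mem⟩ * (1 - Y d.fst d.snd)

/-- Column `k` of the matrix `B`, as a vector of Euclidean space. -/
def columnVec (B : Matrix V V ℝ) (k : V) : EuclideanSpace ℝ V :=
  WithLp.toLp 2 fun i => B i k

/-- The uniform (rotation invariant) probability measure on the unit sphere of `ℝ^V`. -/
noncomputable def sphereUniform (V : Type*) [Fintype V] :
    Measure (Metric.sphere (0 : EuclideanSpace ℝ V) 1) :=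
  ((volume : Measure (EuclideanSpace ℝ V)).toSphere Set.univ)⁻¹ •
    (volume : Measure (EuclideanSpace ℝ V)).toSphere

/-- Hyperplane rounding in direction `r`: the vertices `k` with `sign(y_k ⬝ r) = 1`, where `y_k` is
column `k` of `B`. -/
noncomputable def gwCut (B : Matrix V V ℝ) (r : EuclideanSpace ℝ V) : Finset V :=
  {k | 0 ≤ inner ℝ (columnVec B k) r}

end MaxCut

/-- The Goemans–Williamson constant `min_{0 < θ ≤ π} (2/π) θ / (1 - cos θ) = 0.878…`. -/
noncomputable def gwConst : ℝ :=
  sInf ((fun θ : ℝ => 2 / Real.pi * (θ / (1 - Real.cos θ))) '' Set.Ioc 0 Real.pi)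

/-! Everything rests on one probability: a uniformly random hyperplane separates two unit vectors at
angle θ with probability θ/π (`sphereUniform_real_separatingSet`). By the definition of `gwConst`
this is at least `gwConst` times (1 - cos θ)/2, which is the share of the edge in the relaxation.
Weighting by w ≥ 0 and summing over edges bounds the expected cut from below; an expectation never
exceeds the maximum cut.

The angle formula is proved without coordinates on the sphere. In a fixed plane, the measure of the
hyperplanes separating the angles 0 and t depends only on t, is nonnegative and is additive on [0,
π]; hence it is linear, with value the total mass at π. This is done for the ball, whose measure is
invariant under isometries, and transferred to the sphere through cones.

Pareto dominance passes directly to the guarantees, because the SDP objective equals `sdpValue` on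
feasible matrices and `gwConst` is positive. -/

/-! ### Cauchy's functional equation on an interval. -/

/-- A nonnegative function that is additive on `[0, L]` is bounded below by the linear function
through the origin with the same value at `L`. -/
theorem linear_le_of_additive_of_nonneg {f : ℝ → ℝ} {L : ℝ} (hL : 0 < L)
    (h_nonneg : ∀ t, 0 ≤ f t)
    (h_add : ∀ s t, 0 ≤ s → 0 ≤ t → s + t ≤ L → f (s + t) = f s + f t)
    {t : ℝ} (ht₀ : 0 ≤ t) (ht : t ≤ L) : t / L * f L ≤ f t := by
  have h_mono : ∀ s t, 0 ≤ s → s ≤ t → t ≤ L → f s ≤ f t := fun s t hs hst htL => by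
    have h := h_add s (t - s) hs (by linarith) (by linarith)
    rw [add_sub_cancel] at h
    linarith [h_nonneg (t - s)]
  have h_zero : f 0 = 0 := by
    have h := h_add 0 0 le_rfl le_rfl (by linarith)
    rw [add_zero] at h
    linarith
  have h_nsmul : ∀ (k : ℕ) (x : ℝ), 0 ≤ x → k * x ≤ L → f (k * x) = k * f x := by
    intro k x hx
    induction k with
    | zero => intro _; simp [h_zero]
    | succ k ih =>
      intro hk
      push_cast at hk ⊢
      rw [add_mul, one_mul, h_add _ _ (by positivity) hx (by linarith), ih (by linarith)]
      ring
  -- Approximate t / L from below by k / (n + 1), where additivity gives the value exactly, and pass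
  -- to t by monotonicity.
  have h_approx : ∀ n : ℕ, (t / L - 1 / ((n : ℝ) + 1)) * f L ≤ f t := by
    intro n
    have hn : (0 : ℝ) < (n : ℝ) + 1 := by positivity
    set k := ⌊t / L * ((n : ℝ) + 1)⌋₊
    have hk : (k : ℝ) ≤ t / L * ((n : ℝ) + 1) := Nat.floor_le (by positivity)
    have hk' : t / L * ((n : ℝ) + 1) < k + 1 := Nat.lt_floor_add_one _
    have hkt : (k : ℝ) * (L / ((n : ℝ) + 1)) ≤ t := by
      calc (k : ℝ) * (L / ((n : ℝ) + 1))
          ≤ t / L * ((n : ℝ) + 1) * (L / ((n : ℝ) + 1)) := by gcongr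
        _ = t := by field_simp
    have h1 : f L = ((n : ℝ) + 1) * f (L / ((n : ℝ) + 1)) := by
      have h := h_nsmul (n + 1) (L / ((n : ℝ) + 1)) (by positivity)
      push_cast at h
      rw [mul_div_cancel₀ _ hn.ne'] at h
      exact h le_rfl
    have h2 := h_nsmul k (L / ((n : ℝ) + 1)) (by positivity) (hkt.trans ht)
    refine le_trans ?_ (h2 ▸ h_mono _ _ (by positivity) hkt ht)
    rw [h1, ← mul_assoc]
    refine mul_le_mul_of_nonneg_right ?_ (h_nonneg _)
    rw [sub_mul, one_div, inv_mul_cancel₀ hn.ne']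
    linarith
  have h_lim : Filter.Tendsto (fun n : ℕ => (t / L - 1 / ((n : ℝ) + 1)) * f L) Filter.atTop
      (nhds ((t / L - 0) * f L)) :=
    (tendsto_const_nhds.sub tendsto_one_div_add_atTop_nhds_zero_nat).mul_const _
  rw [sub_zero] at h_lim
  exact le_of_tendsto' h_lim h_approx

/-- A nonnegative function that is additive on `[0, L]` is linear there. -/
theorem eq_linear_of_additive_of_nonneg {f : ℝ → ℝ} {L : ℝ} (hL : 0 < L)
    (h_nonneg : ∀ t, 0 ≤ f t)
    (h_add : ∀ s t, 0 ≤ s → 0 ≤ t → s + t ≤ L → f (s + t) = f s + f t)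
    {t : ℝ} (ht₀ : 0 ≤ t) (ht : t ≤ L) : f t = t / L * f L := by
  refine le_antisymm ?_ (linear_le_of_additive_of_nonneg hL h_nonneg h_add ht₀ ht)
  -- The lower bound at L - t is the upper bound at t, since the two values add up to f L.
  have h1 := linear_le_of_additive_of_nonneg hL h_nonneg h_add (t := L - t) (by linarith)
    (by linarith)
  have h2 := h_add t (L - t) ht₀ (by linarith) (by linarith)
  rw [add_sub_cancel] at h2
  rw [sub_div, div_self hL.ne', sub_mul, one_mul] at h1
  linarith

/-! ### Separating hyperplanes under a rotation invariant measure. -/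

section Separation

variable {E : Type*} [NormedAddCommGroup E] [InnerProductSpace ℝ E]

/-- The points `x` such that exactly one of `u ⬝ x` and `v ⬝ x` is nonnegative, i.e. the hyperplane
orthogonal to `x` separates `u` from `v`. -/
def separatingSet (u v : E) : Set E :=
  {x | ¬(0 ≤ inner ℝ u x ↔ 0 ≤ inner ℝ v x)}

theorem separatingSet_comm (u v : E) : separatingSet u v = separatingSet v u := by
  ext x
  simp only [separatingSet, Set.mem_ofPred_eq, iff_comm]

theorem smul_mem_separatingSet_iff (u v : E) {c : ℝ} (hc : 0 < c) (x : E) :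
    c • x ∈ separatingSet u v ↔ x ∈ separatingSet u v := by
  simp only [separatingSet, Set.mem_ofPred_eq, inner_smul_right, mul_nonneg_iff_of_pos_left hc]

theorem preimage_separatingSet (e : E ≃ₗᵢ[ℝ] E) (u v : E) :
    e ⁻¹' separatingSet (e u) (e v) = separatingSet u v := by
  ext x
  simp only [separatingSet, Set.mem_preimage, Set.mem_ofPred_eq, LinearIsometryEquiv.inner_map_map]

/-- The vector at angle `t` in the plane with orthonormal basis `a, b`. -/
noncomputable def planeVec (a b : E) (t : ℝ) : E :=
  Real.cos t • a + Real.sin t • b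

theorem planeVec_zero (a b : E) : planeVec a b 0 = a := by
  simp [planeVec]

theorem planeVec_pi (a b : E) : planeVec a b Real.pi = -a := by
  simp [planeVec]

theorem inner_planeVec {a b : E} (ha : ‖a‖ = 1) (hb : ‖b‖ = 1) (hab : inner ℝ a b = 0)
    (s t : ℝ) : inner ℝ (planeVec a b s) (planeVec a b t) = Real.cos (s - t) := by
  have hba : inner ℝ b a = 0 := by rw [real_inner_comm, hab]
  simp only [planeVec, inner_add_left, inner_add_right, real_inner_smul_left,
    real_inner_smul_right, real_inner_self_eq_norm_sq, ha, hb, hab, hba, Real.cos_sub]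
  ring

/-- Writes an intermediate direction as a combination of the two outer ones, with nonnegative
coefficients when s and t are nonnegative and s + t < π; signs of inner products then carry over to
it. -/
theorem sin_add_smul_planeVec (a b : E) (s t : ℝ) :
    Real.sin (s + t) • planeVec a b s
      = Real.sin t • planeVec a b 0 + Real.sin s • planeVec a b (s + t) := by
  simp only [planeVec, Real.cos_zero, Real.sin_zero, Real.sin_add, Real.cos_add, smul_add,
    smul_smul, one_smul, zero_smul, add_zero]
  rw [← add_assoc, ← add_smul]
  congr 2
  · linear_combination Real.sin t * Real.sin_sq_add_cos_sq s
  · ring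

/-- Reflection of the plane in its line at angle `c / 2`. -/
theorem reflection_planeVec {a b : E} (ha : ‖a‖ = 1) (hb : ‖b‖ = 1) (hab : inner ℝ a b = 0)
    (c t : ℝ) : (ℝ ∙ planeVec a b (c / 2)).reflection (planeVec a b t) = planeVec a b (c - t) := by
  have hn : ‖planeVec a b (c / 2)‖ = 1 := by
    rw [← sq_eq_sq₀ (norm_nonneg _) zero_le_one, ← real_inner_self_eq_norm_sq,
      inner_planeVec ha hb hab, sub_self, Real.cos_zero, one_pow]
  rw [Submodule.reflection_singleton_apply, inner_planeVec ha hb hab, hn, RCLike.ofReal_one,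
    one_pow, div_one]
  have h1 : c - t = c / 2 + (c / 2 - t) := by ring
  have h2 : t = c / 2 - (c / 2 - t) := by ring
  rw [h1]
  nth_rewrite 2 [h2]
  generalize c / 2 - t = y
  simp only [planeVec, Real.cos_add, Real.sin_add, Real.cos_sub, Real.sin_sub]
  module

/-- For `x` not orthogonal to `a`, the sign of the inner product with `x` changes at most once
along a half-turn: if it agrees at the angles `0` and `s + t ≤ π`, then also at `0` and `s`. -/
theorem nonneg_inner_planeVec_iff_of_add {a b x : E} (hx : inner ℝ a x ≠ 0) {s t : ℝ}
    (hs : 0 ≤ s) (ht : 0 ≤ t) (hst : s + t ≤ Real.pi) :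
    (0 ≤ inner ℝ (planeVec a b 0) x ↔ 0 ≤ inner ℝ (planeVec a b (s + t)) x) →
    (0 ≤ inner ℝ (planeVec a b 0) x ↔ 0 ≤ inner ℝ (planeVec a b s) x) := by
  intro h
  rcases hst.eq_or_lt with hst | hst
  · rw [hst, planeVec_zero, planeVec_pi, inner_neg_left] at h
    rcases hx.lt_or_gt with hx | hx
    · exact absurd (h.2 (by linarith)) (by linarith)
    · exact absurd (h.1 hx.le) (by linarith)
  rcases hs.eq_or_lt with rfl | hs
  · rfl
  have h_sin : 0 < Real.sin (s + t) := Real.sin_pos_of_pos_of_lt_pi (by linarith) hst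
  have h_sin_s : 0 < Real.sin s := Real.sin_pos_of_pos_of_lt_pi hs (by linarith)
  have h_sin_t : 0 ≤ Real.sin t := Real.sin_nonneg_of_nonneg_of_le_pi ht (by linarith)
  have h_inner := congrArg (fun v => inner ℝ v x) (sin_add_smul_planeVec a b s t)
  simp only [inner_add_left, real_inner_smul_left] at h_inner
  constructor
  · intro h0
    have h1 := h.1 h0
    exact nonneg_of_mul_nonneg_right (h_inner ▸ by positivity) h_sin
  · intro hs'
    by_contra h0
    have h1 : ¬ 0 ≤ inner ℝ (planeVec a b (s + t)) x := fun h' => h0 (h.2 h')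
    push Not at h0 h1
    have h2 := mul_nonneg h_sin.le hs'
    have h3 := mul_neg_of_pos_of_neg h_sin_s h1
    have h4 := mul_nonpos_of_nonneg_of_nonpos h_sin_t h0.le
    linarith

variable [MeasurableSpace E] [BorelSpace E]

theorem measurableSet_separatingSet [SecondCountableTopology E] (u v : E) :
    MeasurableSet (separatingSet u v) := by
  have h : ∀ w : E, MeasurableSet {x | 0 ≤ inner ℝ w x} := fun w =>
    (isClosed_le continuous_const (by fun_prop)).measurableSet
  exact ((h u).iff (h v)).compl

variable [SecondCountableTopology E] (μ : Measure E)

/-- The reflection in the line at angle (s + t) / 2 sends the angles s and s + t to t and 0. The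
order of the pair does not matter, so no rotation is needed. -/
theorem measureReal_separatingSet_planeVec_add
    (h_inv : ∀ e : E ≃ₗᵢ[ℝ] E, MeasurePreserving e μ μ)
    {a b : E} (ha : ‖a‖ = 1) (hb : ‖b‖ = 1) (hab : inner ℝ a b = 0) (s t : ℝ) :
    μ.real (separatingSet (planeVec a b s) (planeVec a b (s + t)))
      = μ.real (separatingSet (planeVec a b 0) (planeVec a b t)) := by
  have h := preimage_separatingSet (ℝ ∙ planeVec a b ((s + t) / 2)).reflection
    (planeVec a b s) (planeVec a b (s + t))
  rw [reflection_planeVec ha hb hab, reflection_planeVec ha hb hab, sub_self,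
    add_sub_cancel_left, separatingSet_comm (planeVec a b t)] at h
  rw [← h]
  exact (h_inv _).measureReal_preimage (measurableSet_separatingSet _ _).nullMeasurableSet

variable [IsFiniteMeasure μ]

/-- Off the null set of x orthogonal to a, the sign changes at most once on a half-turn. So
separating 0 from s + t means separating 0 from s or s from s + t, never both, which gives
additivity. -/
theorem measureReal_separatingSet_planeVec
    (h_inv : ∀ e : E ≃ₗᵢ[ℝ] E, MeasurePreserving e μ μ)
    (h_null : ∀ u : E, u ≠ 0 → ∀ᵐ x ∂μ, inner ℝ u x ≠ 0)
    {a b : E} (ha : ‖a‖ = 1) (hb : ‖b‖ = 1) (hab : inner ℝ a b = 0) {t : ℝ} (ht₀ : 0 ≤ t)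
    (ht : t ≤ Real.pi) :
    μ.real (separatingSet a (planeVec a b t)) = t / Real.pi * μ.real Set.univ := by
  have ha₀ : ∀ᵐ x ∂μ, inner ℝ a x ≠ 0 := h_null a (by rintro rfl; simp at ha)
  have h_pi : μ.real (separatingSet a (planeVec a b Real.pi)) = μ.real Set.univ := by
    refine measureReal_congr ?_
    filter_upwards [ha₀] with x hx
    refine propext (iff_of_true (fun h => ?_) trivial)
    rw [planeVec_pi, inner_neg_left] at h
    rcases hx.lt_or_gt with hx | hx
    · exact absurd (h.2 (by linarith)) (by linarith)
    · exact absurd (h.1 hx.le) (by linarith)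
  rw [← h_pi]
  refine eq_linear_of_additive_of_nonneg
    (f := fun t => μ.real (separatingSet a (planeVec a b t))) Real.pi_pos
    (fun _ => measureReal_nonneg) (fun s t hs ht hst => ?_) ht₀ ht
  have h_shift := measureReal_separatingSet_planeVec_add μ h_inv ha hb hab s t
  rw [planeVec_zero] at h_shift
  rw [← h_shift, ← measureReal_union₀ (measurableSet_separatingSet _ _).nullMeasurableSet]
  · refine measureReal_congr ?_
    filter_upwards [ha₀] with x hx
    have h := nonneg_inner_planeVec_iff_of_add (b := b) hx hs ht hst
    rw [planeVec_zero] at h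
    change (x ∈ separatingSet _ _) = (x ∈ separatingSet _ _ ∪ separatingSet _ _)
    simp only [separatingSet, Set.mem_union, Set.mem_ofPred_eq, eq_iff_iff]
    tauto
  · refine measure_mono_null (t := {x | ¬ inner ℝ a x ≠ 0}) ?_ ha₀
    rintro x ⟨h1, h2⟩ hx
    have h := nonneg_inner_planeVec_iff_of_add (b := b) hx hs ht hst
    rw [planeVec_zero] at h
    simp only [separatingSet, Set.mem_ofPred_eq] at h1 h2
    tauto

/-- **Goemans–Williamson**: under a rotation invariant measure, the proportion of the hyperplanes
through the origin that separate two unit vectors is their angle divided by `π`. -/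
theorem measureReal_separatingSet
    (h_inv : ∀ e : E ≃ₗᵢ[ℝ] E, MeasurePreserving e μ μ)
    (h_null : ∀ u : E, u ≠ 0 → ∀ᵐ x ∂μ, inner ℝ u x ≠ 0)
    {u v : E} (hu : ‖u‖ = 1) (hv : ‖v‖ = 1) :
    μ.real (separatingSet u v) = Real.arccos (inner ℝ u v) / Real.pi * μ.real Set.univ := by
  have h_eq : ∀ b : E, ‖b‖ = 1 → inner ℝ u b = 0 →
      v = planeVec u b (Real.arccos (inner ℝ u v)) →
      μ.real (separatingSet u v) = Real.arccos (inner ℝ u v) / Real.pi * μ.real Set.univ := by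
    intro b hb hub h
    have h' := measureReal_separatingSet_planeVec μ h_inv h_null hu hb hub
      (Real.arccos_nonneg (inner ℝ u v)) (Real.arccos_le_pi _)
    rwa [← h] at h'
  have h_abs := abs_real_inner_le_norm u v
  rw [hu, hv, one_mul, abs_le] at h_abs
  set c := inner ℝ u v with hc
  -- If v = ±u there is no plane to work in; otherwise Gram–Schmidt supplies the second basis
  -- vector.
  by_cases hw : v - c • u = 0
  · have hv' : v = c • u := sub_eq_zero.1 hw
    have hc1 : |c| = 1 := by
      have h := congrArg norm hv'
      rwa [norm_smul, hu, hv, mul_one, Real.norm_eq_abs, eq_comm] at h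
    rcases eq_or_eq_neg_of_abs_eq hc1 with h1 | h1
    · rw [h1, one_smul] at hv'
      simp [h1, hv', separatingSet]
    · rw [h1, neg_one_smul] at hv'
      rw [h1, Real.arccos_neg_one, div_self Real.pi_ne_zero, one_mul, hv']
      refine measureReal_congr ?_
      filter_upwards [h_null u (by rintro rfl; simp at hu)] with x hx
      refine propext (iff_of_true (fun h => ?_) trivial)
      rw [inner_neg_left] at h
      rcases hx.lt_or_gt with hx | hx
      · exact absurd (h.2 (by linarith)) (by linarith)
      · exact absurd (h.1 hx.le) (by linarith)
  · have hw_norm : ‖v - c • u‖ = Real.sqrt (1 - c ^ 2) := by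
      rw [← Real.sqrt_sq (norm_nonneg (v - c • u)), norm_sub_sq_real, real_inner_smul_right,
        norm_smul, hu, hv, real_inner_comm, ← hc, Real.norm_eq_abs, mul_one, sq_abs]
      congr 1
      ring
    refine h_eq (‖v - c • u‖⁻¹ • (v - c • u)) ?_ ?_ ?_
    · rw [norm_smul, norm_inv, norm_norm, inv_mul_cancel₀ (norm_ne_zero_iff.2 hw)]
    · rw [real_inner_smul_right, inner_sub_right, real_inner_smul_right,
        real_inner_self_eq_norm_sq, hu, ← hc]
      ring
    · rw [planeVec, Real.cos_arccos h_abs.1 h_abs.2, Real.sin_arccos, ← hw_norm, smul_smul,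
        mul_inv_cancel₀ (norm_ne_zero_iff.2 hw), one_smul]
      abel

end Separation

/-! ### From the ball to the sphere. -/

section Sphere

variable {V : Type*} [Fintype V]

theorem ae_inner_ne_zero {E : Type*} [NormedAddCommGroup E] [InnerProductSpace ℝ E]
    [FiniteDimensional ℝ E] [MeasurableSpace E] [BorelSpace E] (μ : Measure E)
    [μ.IsAddHaarMeasure] {u : E} (hu : u ≠ 0) : ∀ᵐ x ∂μ, inner ℝ u x ≠ 0 := by
  have h := Measure.addHaar_submodule μ (LinearMap.ker (innerSL ℝ u : E →L[ℝ] ℝ).toLinearMap)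
    (fun h => hu ?_)
  · rw [ae_iff]
    refine measure_mono_null (fun x hx => ?_) h
    simpa using hx
  · have h1 : u ∈ LinearMap.ker (innerSL ℝ u : E →L[ℝ] ℝ).toLinearMap := h ▸ Submodule.mem_top
    simpa using h1

theorem isProbabilityMeasure_sphereUniform [Nonempty V] :
    IsProbabilityMeasure (sphereUniform V) := by
  constructor
  rw [sphereUniform, Measure.smul_apply, smul_eq_mul]
  exact ENNReal.inv_mul_cancel
    (by rw [Ne, Measure.measure_univ_eq_zero]; exact Measure.toSphere_ne_zero _)
    (measure_ne_top _ _)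

open scoped Pointwise in
/-- The uniform measure of the trace on the sphere of a cone `C` is the proportion of the ball
that `C` occupies. -/
theorem sphereUniform_real_preimage_cone [Nonempty V] {C : Set (EuclideanSpace ℝ V)}
    (hC : MeasurableSet C) (h_cone : ∀ c : ℝ, 0 < c → ∀ x, c • x ∈ C ↔ x ∈ C) :
    (sphereUniform V).real ((↑) ⁻¹' C)
      = ((volume : Measure (EuclideanSpace ℝ V)).restrict (Metric.ball 0 1)).real C
        / ((volume : Measure (EuclideanSpace ℝ V)).restrict (Metric.ball 0 1)).real Set.univ := by
  have h_set : Set.Ioo (0 : ℝ) 1 • ((↑) '' ((↑) ⁻¹' C : Set (Metric.sphere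
      (0 : EuclideanSpace ℝ V) 1)) : Set (EuclideanSpace ℝ V)) = (C ∩ Metric.ball 0 1) \ {0} := by
    ext x
    rw [Set.mem_smul]
    constructor
    · rintro ⟨c, hc, _, ⟨y, hy, rfl⟩, rfl⟩
      have hy1 : ‖(y : EuclideanSpace ℝ V)‖ = 1 := norm_eq_of_mem_sphere y
      refine ⟨⟨(h_cone c hc.1 _).2 hy, ?_⟩, ?_⟩
      · rw [mem_ball_zero_iff, norm_smul, hy1, mul_one, Real.norm_eq_abs, abs_of_pos hc.1]
        exact hc.2
      · rw [Set.mem_singleton_iff, smul_eq_zero, not_or, ← norm_eq_zero (a := (y : EuclideanSpace ℝ V)), hy1]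
        exact ⟨hc.1.ne', one_ne_zero⟩
    · rintro ⟨⟨hxC, hx1⟩, hx0⟩
      have hx0' : 0 < ‖x‖ := norm_pos_iff.2 hx0
      refine ⟨‖x‖, ⟨hx0', mem_ball_zero_iff.1 hx1⟩, ‖x‖⁻¹ • x, ⟨⟨‖x‖⁻¹ • x, ?_⟩, ?_, rfl⟩, ?_⟩
      · rw [mem_sphere_zero_iff_norm, norm_smul, norm_inv, norm_norm, inv_mul_cancel₀ hx0'.ne']
      · exact (h_cone _ (inv_pos.2 hx0') _).2 hxC
      · rw [smul_smul, mul_inv_cancel₀ hx0'.ne', one_smul]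
  have h_meas : MeasurableSet ((↑) ⁻¹' C : Set (Metric.sphere (0 : EuclideanSpace ℝ V) 1)) :=
    measurable_subtype_coe hC
  -- `toSphere` scales cone volumes by the dimension; this factor cancels in the ratio.
  have h_dim : ((Module.finrank ℝ (EuclideanSpace ℝ V) : ℕ) : ℝ) ≠ 0 := by
    simp [Fintype.card_ne_zero]
  rw [sphereUniform, measureReal_ennreal_smul_apply, ENNReal.toReal_inv, ← measureReal_def,
    Measure.toSphere_real_apply_univ, measureReal_def (Measure.toSphere _), Measure.toSphere_apply' _ h_meas, h_set,
    measure_sdiff_null (measure_singleton _), ENNReal.toReal_mul, ENNReal.toReal_natCast,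
    ← measureReal_def, measureReal_restrict_apply hC, measureReal_restrict_apply MeasurableSet.univ,
    Set.univ_inter, mul_inv, mul_comm (_⁻¹) (_⁻¹), mul_assoc, inv_mul_cancel_left₀ h_dim,
    inv_mul_eq_div]

/-- A uniformly random hyperplane through the origin separates two unit vectors with probability
equal to their angle divided by `π`. -/
theorem sphereUniform_real_separatingSet [Nonempty V] {u v : EuclideanSpace ℝ V}
    (hu : ‖u‖ = 1) (hv : ‖v‖ = 1) :
    (sphereUniform V).real ((↑) ⁻¹' separatingSet u v)
      = Real.arccos (inner ℝ u v) / Real.pi := by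
  rw [sphereUniform_real_preimage_cone (measurableSet_separatingSet u v)
    (fun c hc x => smul_mem_separatingSet_iff u v hc x)]
  set μ := (volume : Measure (EuclideanSpace ℝ V)).restrict (Metric.ball 0 1) with hμ
  have : IsFiniteMeasure μ := isFiniteMeasure_restrict.2 measure_ball_lt_top.ne
  have h_univ : μ.real Set.univ ≠ 0 := by
    rw [hμ, measureReal_restrict_apply MeasurableSet.univ, Set.univ_inter]
    exact (ENNReal.toReal_pos (Metric.measure_ball_pos _ _ one_pos).ne'
      measure_ball_lt_top.ne).ne'
  rw [measureReal_separatingSet μ (fun e => ?_) (fun w hw => ?_) hu hv, mul_div_cancel_right₀ _ h_univ]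
  · have h := (e.measurePreserving).restrict_preimage
      (measurableSet_ball (x := (0 : EuclideanSpace ℝ V)) (ε := 1))
    rwa [e.preimage_ball, map_zero] at h
  · exact ae_restrict_of_ae (ae_inner_ne_zero volume hw)

end Sphere

/-! ### Numerical bounds for the Goemans–Williamson constant. -/

/-- The function whose infimum over `(0, π]` is `gwConst` is at least `0.8781`. -/
theorem mul_one_sub_cos_le {θ : ℝ} (h₀ : 0 ≤ θ) (hπ : θ ≤ Real.pi) :
    0.8781 * (1 - Real.cos θ) ≤ 2 / Real.pi * θ := by
  have h_pi := Real.pi_pos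
  rcases le_total θ (Real.pi / 2) with h | h
  · have h1 := Real.one_sub_mul_le_cos h₀ h
    have h2 := Real.cos_le_one θ
    linarith
  · obtain ⟨y, rfl⟩ : ∃ y, θ = y + 3 * Real.pi / 4 := ⟨θ - 3 * Real.pi / 4, by ring⟩
    have h_lt := Real.pi_lt_d4
    have h_gt := Real.pi_gt_d4
    have hy : |y| ≤ 0.7854 := abs_le.2 ⟨by linarith, by linarith⟩
    have hy' : |y| ≤ 1 := hy.trans (by norm_num)
    have h_cos := (abs_le.1 (Real.cos_bound hy')).2
    have h_sin := (abs_le.1 (Real.sin_bound hy')).2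
    have h_angle : Real.cos (3 * Real.pi / 4) = -(√2 / 2) ∧ Real.sin (3 * Real.pi / 4) = √2 / 2 := by
      have : 3 * Real.pi / 4 = Real.pi - Real.pi / 4 := by ring
      rw [this, Real.cos_pi_sub, Real.sin_pi_sub, Real.cos_pi_div_four, Real.sin_pi_div_four]
      exact ⟨rfl, rfl⟩
    have h_sqrt : √2 < 1.414214 := (Real.sqrt_lt' (by norm_num)).2 (by norm_num)
    -- The Taylor coefficient -1/2 is weakened to -0.3 to absorb the cubic term and the remainders.
    have h_sum : Real.sin y + Real.cos y ≤ 1 + y - 0.3 * y ^ 2 := by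
      have h2 : |y| ^ 2 = y ^ 2 := sq_abs y
      have h3 : -y ^ 3 ≤ 0.7854 * y ^ 2 := by
        nlinarith [sq_nonneg y, (abs_le.1 hy).1]
      have h4 : |y| ^ 4 ≤ 0.7854 ^ 2 * y ^ 2 := by
        calc |y| ^ 4 = |y| ^ 2 * y ^ 2 := by rw [← h2]; ring
          _ ≤ 0.7854 ^ 2 * y ^ 2 := by gcongr
      have h5 : |y| ^ 5 ≤ 0.7854 ^ 3 * y ^ 2 := by
        calc |y| ^ 5 = |y| ^ 3 * y ^ 2 := by rw [← h2]; ring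
          _ ≤ 0.7854 ^ 3 * y ^ 2 := by gcongr
      nlinarith [sq_nonneg y]
    have h_pos : 0 ≤ 1 + y - 0.3 * y ^ 2 := by
      nlinarith [(abs_le.1 hy).1, (abs_le.1 hy).2]
    have h_mul : √2 / 2 * (Real.sin y + Real.cos y) ≤ 0.707107 * (1 + y - 0.3 * y ^ 2) :=
      (mul_le_mul_of_nonneg_left h_sum (by positivity)).trans
        (mul_le_mul_of_nonneg_right (by linarith) h_pos)
    have h_lin : 0.63662 * y - 0.00002 + 1.5 ≤ 2 / Real.pi * (y + 3 * Real.pi / 4) := by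
      have h1 : 2 / Real.pi * (y + 3 * Real.pi / 4) = 2 / Real.pi * y + 1.5 := by
        field_simp
        ring
      have h2 : 0.6366 ≤ 2 / Real.pi := by rw [le_div_iff₀ h_pi]; linarith
      have h3 : 2 / Real.pi ≤ 0.63664 := by rw [div_le_iff₀ h_pi]; linarith
      have h4 : |(2 / Real.pi - 0.63662) * y| ≤ 0.00002 * 1 := by
        rw [abs_mul]
        exact mul_le_mul (abs_le.2 ⟨by linarith, by linarith⟩) hy' (abs_nonneg _) (by norm_num)
      linarith [(abs_le.1 h4).1]
    rw [Real.cos_add, h_angle.1, h_angle.2]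
    refine le_trans ?_ h_lin
    nlinarith [sq_nonneg (y + 0.03)]

theorem gwConst_bounds : 0.878 < gwConst ∧ gwConst < 0.879 := by
  have h_bound : ∀ x ∈ (fun θ : ℝ => 2 / Real.pi * (θ / (1 - Real.cos θ))) '' Set.Ioc 0 Real.pi,
      0.8781 ≤ x := by
    rintro _ ⟨θ, ⟨h₀, hπ⟩, rfl⟩
    have h_cos : Real.cos θ < 1 := by
      simpa using Real.cos_lt_cos_of_nonneg_of_le_pi le_rfl hπ h₀
    dsimp only
    rw [← mul_div_assoc, le_div_iff₀ (by linarith)]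
    exact mul_one_sub_cos_le h₀.le hπ
  constructor
  · exact lt_of_lt_of_le (by norm_num) (le_csInf
      ((Set.nonempty_Ioc.2 Real.pi_pos).image _) h_bound)
  -- At 3π/4 the ratio is 1.5 / (1 + √2 / 2) ≈ 0.8787.
  · refine lt_of_le_of_lt (csInf_le ⟨_, h_bound⟩ ⟨3 * Real.pi / 4,
      ⟨by positivity, by linarith [Real.pi_pos]⟩, rfl⟩) ?_
    have h_cos : Real.cos (3 * Real.pi / 4) = -(√2 / 2) := by
      rw [show 3 * Real.pi / 4 = Real.pi - Real.pi / 4 by ring, Real.cos_pi_sub,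
        Real.cos_pi_div_four]
    have h_sqrt : 1.414 < √2 := (Real.lt_sqrt (by norm_num)).2 (by norm_num)
    have h_eq : 2 / Real.pi * (3 * Real.pi / 4 / (1 - -(√2 / 2))) = 1.5 / (1 + √2 / 2) := by
      have h_pi := Real.pi_ne_zero
      rw [sub_neg_eq_add, ← mul_div_assoc]
      congr 1
      field_simp
      norm_num
    dsimp only
    rw [h_cos, h_eq, div_lt_iff₀ (by positivity)]
    linarith

theorem gwConst_mul_one_sub_cos_le {θ : ℝ} (h₀ : 0 ≤ θ) (hπ : θ ≤ Real.pi) :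
    gwConst * (1 - Real.cos θ) ≤ 2 / Real.pi * θ := by
  rcases h₀.eq_or_lt with rfl | h₀
  · simp
  have h_cos : Real.cos θ < 1 := by
    simpa using Real.cos_lt_cos_of_nonneg_of_le_pi le_rfl hπ h₀
  rw [← le_div_iff₀ (by linarith), mul_div_assoc]
  refine csInf_le ⟨0, ?_⟩ ⟨θ, ⟨h₀, hπ⟩, rfl⟩
  rintro _ ⟨φ, ⟨hφ, -⟩, rfl⟩
  have h1 := Real.cos_le_one φ
  have h2 := Real.pi_pos
  exact mul_nonneg (by positivity) (div_nonneg hφ.le (by linarith))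

theorem card_toFinset_inter_eq_one_iff {V : Type*} [DecidableEq V] {i j : V} (hij : i ≠ j) (S : Finset V) :
    (s(i, j).toFinset ∩ S).card = 1 ↔ ¬(i ∈ S ↔ j ∈ S) := by
  rw [Sym2.toFinset_mk_eq]
  by_cases hi : i ∈ S <;> by_cases hj : j ∈ S <;>
    simp [Finset.insert_inter_of_mem, Finset.insert_inter_of_notMem, hi, hj, hij]

theorem inner_columnVec {V : Type*} [Fintype V] (B : Matrix V V ℝ) (i j : V) :
    inner ℝ (columnVec B i) (columnVec B j) = (B.transpose * B) i j := by
  simp [columnVec, Matrix.mul_apply, PiLp.inner_apply, mul_comm]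

theorem norm_columnVec {V : Type*} [Fintype V] {B : Matrix V V ℝ} (hB : ∀ i, (B.transpose * B) i i = 1) (i : V) :
    ‖columnVec B i‖ = 1 := by
  rw [← sq_eq_sq₀ (norm_nonneg _) zero_le_one, ← real_inner_self_eq_norm_sq, inner_columnVec, hB,
    one_pow]

/-! ### Edge sums, the SDP value and the expected rounded cut. -/

section MaxCut

variable {V : Type*} [Fintype V] [DecidableEq V] (G : SimpleGraph V) [DecidableRel G.Adj]

/-- The sum over ordered pairs of adjacent vertices counts every edge twice. -/
theorem sum_dart_eq_two_mul_sum_edgeSet (f : Sym2 V → ℝ) :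
    ∑ d : G.Dart, f d.edge = 2 * ∑ e : G.edgeSet, f e := by
  rw [Finset.mul_sum, ← Finset.sum_fiberwise_of_maps_to (t := Finset.univ)
    (g := fun d : G.Dart => (⟨d.edge, d.edge_mem⟩ : G.edgeSet)) (fun _ _ => Finset.mem_univ _)]
  refine Finset.sum_congr rfl fun e _ => ?_
  rw [Finset.sum_congr rfl (g := fun _ => f e), Finset.sum_const]
  · have h := G.dart_edge_fiber_card e e.2
    simp only [Subtype.ext_iff]
    rw [h, two_nsmul, two_mul]
  · intro d hd
    rw [← (Finset.mem_filter.1 hd).2]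

/-- The symmetrized value of a function of two vertices, as a function of the edge. -/
noncomputable def edgeMean (f : V → V → ℝ) : Sym2 V → ℝ :=
  Sym2.lift ⟨fun i j => (f i j + f j i) / 2, fun i j => by dsimp only; rw [add_comm]⟩

/-- Symmetry of Y makes both orientations of an edge contribute equally, turning the factor 1/4 into
1/2. -/
theorem sdpValue_eq_sum_edgeSet (w : G.edgeSet → ℝ) {Y : Matrix V V ℝ} (hY : Y.IsHermitian) :
    sdpValue G w Y = ∑ e : G.edgeSet, w e * ((1 - edgeMean Y e) / 2) := by
  have h := sum_dart_eq_two_mul_sum_edgeSet G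
    (fun e => if he : e ∈ G.edgeSet then w ⟨e, he⟩ * (1 - edgeMean Y e) else 0)
  simp only [SimpleGraph.Dart.edge_mem, Subtype.coe_prop, dite_true, Subtype.coe_eta] at h
  have h_dart : ∀ d : G.Dart, edgeMean Y d.edge = Y d.fst d.snd := by
    intro d
    have h_symm : Y d.snd d.fst = Y d.fst d.snd := by simpa using hY.apply d.fst d.snd
    change (Y d.fst d.snd + Y d.snd d.fst) / 2 = _
    rw [h_symm]
    ring
  simp only [h_dart] at h
  rw [sdpValue, h, ← mul_assoc, Finset.mul_sum]
  exact Finset.sum_congr rfl fun e _ => by ring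

theorem trace_edgeLaplacian_transpose_mul {Y : Matrix V V ℝ} (hY : ∀ i, Y i i = 1) (e : Sym2 V) :
    Matrix.trace ((edgeLaplacian e).transpose * Y) = 2 * (1 - edgeMean Y e) := by
  induction e with
  | _ i j =>
    change Matrix.trace ((Matrix.single i i 1 + Matrix.single j j 1
      - Matrix.single i j 1 - Matrix.single j i (1 : ℝ)).transpose * Y)
        = 2 * (1 - (Y i j + Y j i) / 2)
    simp only [Matrix.transpose_sub, Matrix.transpose_add, Matrix.transpose_single,
      Matrix.sub_mul, Matrix.add_mul, Matrix.trace_sub, Matrix.trace_add,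
      Matrix.trace_single_mul, hY, smul_eq_mul]
    ring

theorem sdpObjective_eq_sdpValue (w : G.edgeSet → ℝ) {Y : Matrix V V ℝ} (hY : Y ∈ sdpFeasible V) :
    sdpObjective G Y w = sdpValue G w Y := by
  rw [sdpValue_eq_sum_edgeSet G w hY.1.isHermitian, sdpObjective, weightedLaplacian]
  simp only [Matrix.transpose_smul, Matrix.transpose_sum, Matrix.smul_mul, Matrix.sum_mul,
    Matrix.trace_smul, Matrix.trace_sum, trace_edgeLaplacian_transpose_mul hY.2, smul_eq_mul]
  rw [Finset.mul_sum]
  exact Finset.sum_congr rfl fun e _ => by ring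

/-- The directions for which hyperplane rounding cuts the edge `e`. -/
def cuttingSet (B : Matrix V V ℝ) (e : Sym2 V) : Set (Metric.sphere (0 : EuclideanSpace ℝ V) 1) :=
  {r | (e.toFinset ∩ gwCut B r).card = 1}

theorem cuttingSet_mk (B : Matrix V V ℝ) {i j : V} (hij : i ≠ j) :
    cuttingSet B s(i, j) = (↑) ⁻¹' separatingSet (columnVec B i) (columnVec B j) := by
  ext r
  simp [cuttingSet, card_toFinset_inter_eq_one_iff hij, gwCut, separatingSet]

theorem measurableSet_cuttingSet (B : Matrix V V ℝ) {e : Sym2 V} (he : ¬ e.IsDiag) :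
    MeasurableSet (cuttingSet B e) := by
  induction e with
  | _ i j =>
    rw [cuttingSet_mk B he]
    exact measurable_subtype_coe (measurableSet_separatingSet _ _)

/-- Hyperplane rounding cuts an edge with probability at least `gwConst` times its share in the
relaxation. -/
theorem gwConst_mul_le_sphereUniform_real_cuttingSet {B : Matrix V V ℝ}
    (hB : ∀ i, (B.transpose * B) i i = 1) {e : Sym2 V} (he : ¬ e.IsDiag) :
    gwConst * ((1 - edgeMean (B.transpose * B) e) / 2)
      ≤ (sphereUniform V).real (cuttingSet B e) := by
  induction e with
  | _ i j =>
    have : Nonempty V := ⟨i⟩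
    have h_abs := abs_real_inner_le_norm (columnVec B i) (columnVec B j)
    rw [norm_columnVec hB, norm_columnVec hB, one_mul, abs_le] at h_abs
    rw [cuttingSet_mk B he, sphereUniform_real_separatingSet (norm_columnVec hB i)
      (norm_columnVec hB j)]
    have h_mean : edgeMean (B.transpose * B) s(i, j)
        = inner ℝ (columnVec B i) (columnVec B j) := by
      change ((B.transpose * B) i j + (B.transpose * B) j i) / 2 = _
      rw [← inner_columnVec, ← inner_columnVec, real_inner_comm (columnVec B i)]
      ring
    have h := gwConst_mul_one_sub_cos_le (Real.arccos_nonneg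
      (inner ℝ (columnVec B i) (columnVec B j))) (Real.arccos_le_pi _)
    rw [Real.cos_arccos h_abs.1 h_abs.2] at h
    rw [h_mean]
    calc _ = gwConst * (1 - inner ℝ (columnVec B i) (columnVec B j)) / 2 := by ring
      _ ≤ 2 / Real.pi * Real.arccos (inner ℝ (columnVec B i) (columnVec B j)) / 2 := by gcongr
      _ = _ := by ring

theorem cutWeight_gwCut_eq_sum_indicator (w : G.edgeSet → ℝ) (B : Matrix V V ℝ)
    (r : Metric.sphere (0 : EuclideanSpace ℝ V) 1) :
    cutWeight G w (gwCut B r)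
      = ∑ e : G.edgeSet, (cuttingSet B (e : Sym2 V)).indicator (fun _ => w e) r := by
  simp only [cutWeight, cuttingSet, Set.indicator_apply, Set.mem_ofPred_eq]

theorem integrable_indicator_cuttingSet [Nonempty V] (B : Matrix V V ℝ) {e : Sym2 V}
    (he : ¬ e.IsDiag) (c : ℝ) :
    Integrable ((cuttingSet B e).indicator fun _ => c) (sphereUniform V) :=
  have := isProbabilityMeasure_sphereUniform (V := V)
  (integrable_const _).indicator (measurableSet_cuttingSet B he)

theorem integrable_cutWeight_gwCut [Nonempty V] (w : G.edgeSet → ℝ) (B : Matrix V V ℝ) :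
    Integrable (fun r : Metric.sphere (0 : EuclideanSpace ℝ V) 1 => cutWeight G w (gwCut B r))
      (sphereUniform V) := by
  simp only [cutWeight_gwCut_eq_sum_indicator]
  exact integrable_finsetSum _ fun e _ =>
    integrable_indicator_cuttingSet B (G.not_isDiag_of_mem_edgeSet e.2) (w e)

theorem integral_cutWeight_gwCut [Nonempty V] (w : G.edgeSet → ℝ) (B : Matrix V V ℝ) :
    ∫ r, cutWeight G w (gwCut B r) ∂(sphereUniform V)
      = ∑ e : G.edgeSet, w e * (sphereUniform V).real (cuttingSet B (e : Sym2 V)) := by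
  simp only [cutWeight_gwCut_eq_sum_indicator]
  rw [integral_finsetSum _ fun e _ =>
    integrable_indicator_cuttingSet B (G.not_isDiag_of_mem_edgeSet e.2) (w e)]
  refine Finset.sum_congr rfl fun e _ => ?_
  rw [integral_indicator_const _ (measurableSet_cuttingSet B (G.not_isDiag_of_mem_edgeSet e.2)),
    smul_eq_mul, mul_comm]

/-- The Goemans–Williamson guarantee for the expected weight of a rounded cut. -/
theorem gwConst_mul_sdpValue_le_integral [Nonempty V] {w : G.edgeSet → ℝ} (hw : ∀ e, 0 ≤ w e)
    {B : Matrix V V ℝ} (hB : B.transpose * B ∈ sdpFeasible V) :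
    gwConst * sdpValue G w (B.transpose * B)
      ≤ ∫ r, cutWeight G w (gwCut B r) ∂(sphereUniform V) := by
  rw [integral_cutWeight_gwCut, sdpValue_eq_sum_edgeSet G w hB.1.isHermitian, Finset.mul_sum]
  refine Finset.sum_le_sum fun e _ => ?_
  rw [mul_left_comm]
  exact mul_le_mul_of_nonneg_left (gwConst_mul_le_sphereUniform_real_cuttingSet hB.2
    (G.not_isDiag_of_mem_edgeSet e.2)) (hw e)

theorem integral_cutWeight_gwCut_le_maxCut [Nonempty V] (w : G.edgeSet → ℝ) (B : Matrix V V ℝ) :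
    ∫ r, cutWeight G w (gwCut B r) ∂(sphereUniform V) ≤ maxCut G w := by
  have := isProbabilityMeasure_sphereUniform (V := V)
  calc _ ≤ ∫ _, maxCut G w ∂(sphereUniform V) :=
        integral_mono (integrable_cutWeight_gwCut G w B) (integrable_const _)
          fun r => Finset.le_sup' (cutWeight G w) (Finset.mem_univ (gwCut B r))
    _ = maxCut G w := by simp

end MaxCut

/-! ### Assembly of the guarantees. -/

theorem mainTheorem8 {V : Type*} [Fintype V] [DecidableEq V] (G : SimpleGraph V)
    [DecidableRel G.Adj] (Z : Set (G.edgeSet → ℝ)) (hZ : ∀ w ∈ Z, ∀ e, 0 ≤ w e)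
    (Ystar Ybar : Matrix V V ℝ)
    (hdom : ParetoDominates (sdpFeasible V) Z (sdpObjective G) Ystar Ybar) :
    (0.878 < gwConst ∧ gwConst < 0.879) ∧
    (∀ w ∈ Z, gwConst * sdpValue G w Ystar ≤ maxCut G w ∧
      gwConst * sdpValue G w Ybar ≤ gwConst * sdpValue G w Ystar) ∧
    (∃ w ∈ Z, gwConst * sdpValue G w Ybar < gwConst * sdpValue G w Ystar) ∧
    (∀ B : Matrix V V ℝ, B.transpose * B = Ystar → ∀ w ∈ Z,
      Integrable (fun r : Metric.sphere (0 : EuclideanSpace ℝ V) 1 => cutWeight G w (gwCut B r))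
         (sphereUniform V) ∧
      gwConst * sdpValue G w Ystar ≤ ∫ r, cutWeight G w (gwCut B r) ∂(sphereUniform V) ∧
      ∫ r, cutWeight G w (gwCut B r) ∂(sphereUniform V) ≤ maxCut G w) := by
  obtain ⟨h_star, h_bar, h_le, w₀, hw₀, h_lt⟩ := hdom
  have h_pos : 0 < gwConst := lt_trans (by norm_num) gwConst_bounds.1
  -- Over an empty vertex set every objective is 0, contradicting strict dominance; the sphere
  -- measure is a probability only for nonempty V.
  have : Nonempty V := by
    by_contra h
    rw [not_nonempty_iff] at h
    simp [sdpObjective, Matrix.trace] at h_lt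
  have h_round : ∀ B : Matrix V V ℝ, B.transpose * B = Ystar → ∀ w ∈ Z,
      gwConst * sdpValue G w Ystar ≤ ∫ r, cutWeight G w (gwCut B r) ∂(sphereUniform V) := by
    rintro B rfl w hw
    exact gwConst_mul_sdpValue_le_integral G (hZ w hw) h_star
  refine ⟨gwConst_bounds, fun w hw => ⟨?_, ?_⟩, ⟨w₀, hw₀, ?_⟩, fun B hB w hw =>
    ⟨integrable_cutWeight_gwCut G w B, h_round B hB w hw,
      integral_cutWeight_gwCut_le_maxCut G w B⟩⟩
  · obtain ⟨B, hB⟩ : ∃ B : Matrix V V ℝ, B.transpose * B = Ystar := by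
      open scoped MatrixOrder in
      obtain ⟨B, hB⟩ := CStarAlgebra.nonneg_iff_eq_star_mul_self.mp h_star.1.nonneg
      exact ⟨B, by rw [hB, Matrix.star_eq_conjTranspose, Matrix.conjTranspose_eq_transpose_of_trivial]⟩
    exact (h_round B hB w hw).trans (integral_cutWeight_gwCut_le_maxCut G w B)
  · rw [← sdpObjective_eq_sdpValue G w h_star, ← sdpObjective_eq_sdpValue G w h_bar]
    exact mul_le_mul_of_nonneg_left (h_le w hw) h_pos.le
  · rw [← sdpObjective_eq_sdpValue G w₀ h_star, ← sdpObjective_eq_sdpValue G w₀ h_bar]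
    exact mul_lt_mul_of_pos_left h_lt h_pos
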